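/- Let $N,q\ge 1$. Let $\mathcal G$ be a directed weighted graph on the nodes $0,1,\dots,N$ (node $0$ is the leader, nodes $1,\dots,N$ are the followers) with weights $a_{ij}\ge 0$, where $a_{ij}>0$ if and only if there is an edge from $j$ to $i$, and $a_{0j}=0$ for all $j$. Let $\mathcal L=\mathcal D-\mathcal A$ be its Laplacian, where $\mathcal A=(a_{ij})$ and $\mathcal D=\mathrm{diag}(d_0,\dots,d_N)$ with $d_i=\sum_{j=0}^N a_{ij}$, and let $H\in\mathbb R^{N\times N}$ be the submatrix of $\mathcal L$ obtained by deleting the row and the column of the leader. Let $S\in\mathbb R^{q\times q}$ and $\varepsilon_1,\varepsilon_2>0$. Assume that 1. $S$ has no eigenvalue with negative real part; 2. $\mathcal G$ contains a directed spanning tree rooted at the leader, i.e. there is a directed path from node $0$ to every other node (the graph is otherwise arbitrary); 3. $\varepsilon_1\le|\mathcal L_{ij}|\le\varepsilon_2$ whenever $\mathcal L_{ij}\ne 0$. Then the smallest real part of an eigenvalue of $H$ satisfies $$\min\mathrm{Re}\,\lambda(H)\;\ge\;\frac{\varepsilon_1^{N}}{N(2\varepsilon_2)^{N-1}},$$ and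 for every real number $\mu$ with $$\mu>\frac{\max\mathrm{Re}\,\lambda(S)\;N(2\varepsilon_2)^{N-1}}{\varepsilon_1^{N}},$$ where $\max\mathrm{Re}\,\lambda(S)$ is the largest real part of an eigenvalue of $S$, the matrix $(I_N\otimes S)-\mu(H\otimes I_q)$ is Hurwitz, i.e. all its eigenvalues have negative real part. -/

import Mathlib

open scoped Kronecker

namespace CoopReg

/-- A directed weighted graph on the nodes `0, 1, …, N`; node `0` is the leader and the nodes
`1, …, N` are the followers. `weight i j` is the weight `a_ij ≥ 0` of the edge from `j` to `i`
(agent `i` receives information from agent `j`), and it is `0` when there is no such edge. The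
leader receives no information, so its row is zero. -/
structure LeaderFollowerGraph (N : ℕ) where
  /-- the adjacency matrix -/
  weight : Matrix (Fin (N + 1)) (Fin (N + 1)) ℝ
  weight_nonneg : ∀ i j, 0 ≤ weight i j
  leader_row : ∀ j, weight 0 j = 0

namespace LeaderFollowerGraph

variable {N : ℕ} (G : LeaderFollowerGraph N)

/-- There is a directed edge from `u` to `v` exactly when `a_vu > 0`. -/
def Edge (u v : Fin (N + 1)) : Prop := 0 < G.weight v u

/-- The graph has a directed spanning tree rooted at the leader: every node is joined to the
leader by a directed path starting at the leader. -/
def HasSpanningTreeFromLeader : Prop := ∀ v, Relation.ReflTransGen G.Edge 0 v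

/-- The degree matrix, with the in-degrees `d_i = ∑ j, a_ij` on the diagonal. -/
def degreeMatrix : Matrix (Fin (N + 1)) (Fin (N + 1)) ℝ :=
  Matrix.diagonal fun i => ∑ j, G.weight i j

/-- The Laplacian matrix: degree matrix minus adjacency matrix. -/
def laplacian : Matrix (Fin (N + 1)) (Fin (N + 1)) ℝ := G.degreeMatrix - G.weight

/-- The follower block `H` of the Laplacian: the leader's row and column are removed. -/
def followerBlock : Matrix (Fin N) (Fin N) ℝ := G.laplacian.submatrix Fin.succ Fin.succ

end LeaderFollowerGraph

/-- The set of (complex) eigenvalues of a real square matrix. -/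
def eigenvalues {n : Type*} [Fintype n] [DecidableEq n] (A : Matrix n n ℝ) : Set ℂ :=
  spectrum ℂ (A.map Complex.ofReal)

/-- The largest real part of an eigenvalue of `A` (attained for nonempty `n`, see
`isGreatest_maxRe`). -/
noncomputable def maxRe {n : Type*} [Fintype n] [DecidableEq n] (A : Matrix n n ℝ) : ℝ :=
  sSup (Complex.re '' eigenvalues A)

/-- The smallest real part of an eigenvalue of `A` (attained for nonempty `n`, see
`isLeast_minRe`). -/
noncomputable def minRe {n : Type*} [Fintype n] [DecidableEq n] (A : Matrix n n ℝ) : ℝ :=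
  sInf (Complex.re '' eigenvalues A)

/-- A real square matrix is Hurwitz if all its eigenvalues have negative real part. -/
def IsHurwitz {n : Type*} [Fintype n] [DecidableEq n] (A : Matrix n n ℝ) : Prop :=
  ∀ z ∈ eigenvalues A, z.re < 0

theorem eigenvalues_finite {n : Type*} [Fintype n] [DecidableEq n] (A : Matrix n n ℝ) :
    (eigenvalues A).Finite :=
  Matrix.finite_spectrum _

theorem eigenvalues_nonempty {n : Type*} [Fintype n] [DecidableEq n] [Nonempty n]
    (A : Matrix n n ℝ) : (eigenvalues A).Nonempty :=
  spectrum.nonempty_of_isAlgClosed_of_finiteDimensional ℂ _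

theorem isGreatest_maxRe {n : Type*} [Fintype n] [DecidableEq n] [Nonempty n]
    (A : Matrix n n ℝ) : IsGreatest (Complex.re '' eigenvalues A) (maxRe A) :=
  have hf := (eigenvalues_finite A).image Complex.re
  ⟨((eigenvalues_nonempty A).image _).csSup_mem hf, fun _ hx => le_csSup hf.bddAbove hx⟩

theorem isLeast_minRe {n : Type*} [Fintype n] [DecidableEq n] [Nonempty n]
    (A : Matrix n n ℝ) : IsLeast (Complex.re '' eigenvalues A) (minRe A) :=
  have hf := (eigenvalues_finite A).image Complex.re
  ⟨((eigenvalues_nonempty A).image _).csInf_mem hf, fun _ hx => csInf_le hf.bddBelow hx⟩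

end CoopReg

open Matrix Finset

namespace CoopReg

/-! ### Eigenvalues of Kronecker combinations and a weighted Gershgorin bound -/

section Eigenvectors

variable {n : Type*} [Fintype n] [DecidableEq n]

/-! The off-diagonal entries of `H` are nonpositive, so a positive `w` with `H w ≥ c w` forces `Re
λ(H) ≥ c` (Gershgorin in the sup norm weighted by `w`). Such a `w` comes from the distance `d` to
the leader: with `r = ε₂ / ε₁` and `T n = 1 + r + ⋯ + r ^ (n - 1)`, put `w v = T N - T (N - d v)`. A
predecessor one step closer and `T (n + 1) = 1 + r * T n` give `H w ≥ ε₁` entrywise, and `w ≤ T N`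
allows `c = ε₁ / T N`. Since `r ≥ 1`, `T N ≤ N * r ^ (N - 1)`, which is better than required by a
factor `2 ^ (N - 1)`. As `1 ⊗ S` and `H ⊗ 1` commute, the eigenvalues in the second claim have the
form `s - μ h`, and the first claim bounds `Re h` from below. -/

theorem mem_spectrum_iff_exists_mulVec (M : Matrix n n ℂ) (z : ℂ) :
    z ∈ spectrum ℂ M ↔ ∃ v : n → ℂ, v ≠ 0 ∧ M *ᵥ v = z • v := by
  rw [← Matrix.spectrum_toLin', ← Module.End.hasEigenvalue_iff_mem_spectrum]
  constructor
  · intro h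
    obtain ⟨v, hv⟩ := h.exists_hasEigenvector
    exact ⟨v, hv.2, by simpa using hv.apply_eq_smul⟩
  · rintro ⟨v, hv, h⟩
    exact Module.End.hasEigenvalue_of_hasEigenvector
      ⟨Module.End.mem_eigenspace_iff.2 (by simpa using h), hv⟩

/-- Commuting endomorphisms of a finite-dimensional complex space: every eigenvalue of one of them
has an eigenvector that is also an eigenvector of the other. -/
theorem exists_common_eigenvector {V : Type*} [AddCommGroup V] [Module ℂ V]
    [FiniteDimensional ℂ V] {f g : Module.End ℂ V} (hfg : Commute f g) {z : ℂ}
    (hz : f.HasEigenvalue z) : ∃ (h : ℂ) (v : V), v ≠ 0 ∧ f v = z • v ∧ g v = h • v := by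
  have hmaps : ∀ x ∈ f.eigenspace z, g x ∈ f.eigenspace z := by
    intro x hx
    rw [Module.End.mem_eigenspace_iff] at hx ⊢
    have := LinearMap.congr_fun hfg.eq x
    simp only [Module.End.mul_apply] at this
    rw [this, hx, map_smul]
  have : Nontrivial (f.eigenspace z) := (Submodule.nontrivial_iff_ne_bot).2 hz
  obtain ⟨h, hh⟩ := Module.End.exists_eigenvalue (g.restrict hmaps)
  obtain ⟨v, hv⟩ := hh.exists_hasEigenvector
  refine ⟨h, v, fun h0 => hv.2 (Subtype.ext h0), Module.End.mem_eigenspace_iff.1 v.2, ?_⟩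
  simpa using congrArg Subtype.val hv.apply_eq_smul

/-- Every eigenvalue of `1 ⊗ S - μ (H ⊗ 1)` is of the form `s - μ h` with eigenvalues `s` of `S`
and `h` of `H`. -/
theorem exists_eigenvalues_of_mem_eigenvalues_kronecker {m : Type*} [Fintype m] [DecidableEq m]
    (H : Matrix n n ℝ) (S : Matrix m m ℝ) (μ : ℝ) {z : ℂ}
    (hz : z ∈ eigenvalues ((1 : Matrix n n ℝ) ⊗ₖ S - μ • (H ⊗ₖ (1 : Matrix m m ℝ)))) :
    ∃ s ∈ eigenvalues S, ∃ h ∈ eigenvalues H, z = s - μ * h := by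
  set A : Matrix (n × m) (n × m) ℂ := (1 : Matrix n n ℂ) ⊗ₖ S.map Complex.ofReal with hA
  set B : Matrix (n × m) (n × m) ℂ := H.map Complex.ofReal ⊗ₖ (1 : Matrix m m ℂ) with hB
  have hmap : ((1 : Matrix n n ℝ) ⊗ₖ S - μ • (H ⊗ₖ (1 : Matrix m m ℝ))).map Complex.ofReal
      = A - (μ : ℂ) • B := by
    ext ⟨i, a⟩ ⟨j, b⟩
    simp [hA, hB, Matrix.one_apply, apply_ite Complex.ofReal]
  have hAB : Commute A B := by
    rw [Commute, SemiconjBy, hA, hB, ← Matrix.mul_kronecker_mul, ← Matrix.mul_kronecker_mul]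
    simp
  rw [eigenvalues, hmap, ← Matrix.spectrum_toLin',
    ← Module.End.hasEigenvalue_iff_mem_spectrum] at hz
  have hcomm : Commute (Matrix.toLin' (A - (μ : ℂ) • B)) (Matrix.toLin' B) := by
    have h : Commute (A - (μ : ℂ) • B) B := hAB.sub_left ((Commute.refl B).smul_left _)
    exact h.map (Matrix.toLinAlgEquiv' (R := ℂ) (n := n × m))
  obtain ⟨h, v, hv0, hv, hBv⟩ := exists_common_eigenvector hcomm hz
  rw [Matrix.toLin'_apply] at hv hBv
  have hAv : A *ᵥ v = (z + μ * h) • v := by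
    rw [Matrix.sub_mulVec, Matrix.smul_mulVec, hBv, sub_eq_iff_eq_add] at hv
    rw [hv, smul_smul, add_smul]
  -- The two slices of `v` through a nonzero entry are nonzero; they are eigenvectors of `S` and of
  -- `H`.
  obtain ⟨⟨i, a⟩, hia⟩ := Function.ne_iff.1 hv0
  refine ⟨z + μ * h, ?_, h, ?_, by ring⟩
  · refine (mem_spectrum_iff_exists_mulVec _ _).2
      ⟨fun b => v (i, b), Function.ne_iff.2 ⟨a, hia⟩, ?_⟩
    ext b
    have := congrFun hAv (i, b)
    simpa [hA, Matrix.mulVec, dotProduct, Fintype.sum_prod_type, Matrix.one_apply] using this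
  · refine (mem_spectrum_iff_exists_mulVec _ _).2
      ⟨fun j => v (j, a), Function.ne_iff.2 ⟨i, hia⟩, ?_⟩
    ext j
    have := congrFun hBv (j, a)
    simpa [hB, Matrix.mulVec, dotProduct, Fintype.sum_prod_type, Matrix.one_apply] using this

/-- A Gershgorin-type bound: if `A` is a real matrix with nonpositive off-diagonal entries and
`A w ≥ c w` for a positive vector `w`, then the eigenvalues of `A` have real part at least `c`. -/
theorem le_re_of_mem_eigenvalues_of_smul_le_mulVec (A : Matrix n n ℝ)
    (hA : ∀ i j, i ≠ j → A i j ≤ 0) {w : n → ℝ} (hw : ∀ i, 0 < w i) {c : ℝ}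
    (hc : ∀ i, c * w i ≤ (A *ᵥ w) i) {z : ℂ} (hz : z ∈ eigenvalues A) : c ≤ z.re := by
  obtain ⟨v, hv0, hv⟩ := (mem_spectrum_iff_exists_mulVec _ _).1 hz
  obtain ⟨k, hk⟩ := Function.ne_iff.1 hv0
  -- The Gershgorin row is the one where the weighted sup norm of `v` is attained.
  obtain ⟨i, -, hi⟩ := exists_max_image univ (fun i => ‖v i‖ / w i) ⟨k, mem_univ k⟩
  set t : ℝ := ‖v i‖ / w i with ht
  have ht0 : 0 < t := lt_of_lt_of_le (div_pos (norm_pos_iff.2 hk) (hw k)) (hi k (mem_univ k))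
  have hvi : ‖v i‖ = t * w i := by rw [ht, div_mul_cancel₀ _ (hw i).ne']
  have hvj : ∀ j, ‖v j‖ ≤ t * w j := fun j => (div_le_iff₀ (hw j)).1 (hi j (mem_univ j))
  have hrow : (z - A i i) * v i = ∑ j ∈ univ.erase i, (A i j : ℂ) * v j := by
    have h := congrFun hv i
    simp only [Matrix.mulVec, dotProduct, Matrix.map_apply, Pi.smul_apply, smul_eq_mul] at h
    rw [← add_sum_erase _ _ (mem_univ i)] at h
    rw [sub_mul, ← h]
    ring
  have hrow' : (A *ᵥ w) i = A i i * w i + ∑ j ∈ univ.erase i, A i j * w j := by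
    simp only [Matrix.mulVec, dotProduct]
    rw [← add_sum_erase _ _ (mem_univ i)]
  have hsum : ‖z - A i i‖ * (t * w i) ≤ t * -∑ j ∈ univ.erase i, A i j * w j := by
    rw [← hvi, ← norm_mul, hrow, ← sum_neg_distrib, mul_sum]
    refine (norm_sum_le _ _).trans (sum_le_sum fun j hj => ?_)
    have hij := hA i j (ne_of_mem_erase hj).symm
    rw [norm_mul, Complex.norm_real, Real.norm_of_nonpos hij]
    nlinarith [hvj j]
  have h1 : ‖z - A i i‖ * w i ≤ (A i i - c) * w i := by
    have : ‖z - A i i‖ * w i ≤ -∑ j ∈ univ.erase i, A i j * w j :=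
      le_of_mul_le_mul_left (by linarith) ht0
    linarith [hc i]
  have h2 : ‖z - A i i‖ ≤ A i i - c := le_of_mul_le_mul_right h1 (hw i)
  have h3 := (abs_le.1 ((Complex.abs_re_le_norm (z - A i i)).trans h2)).1
  simp only [Complex.sub_re, Complex.ofReal_re] at h3
  linarith

end Eigenvectors

/-! ### Distance from the root -/

/-- If every vertex is reachable from `a`, then the distance from `a` is a function bounded by the
number of vertices minus one, and every other vertex has a predecessor that is one closer. -/
theorem exists_level_of_reflTransGen {V : Type*} [Fintype V] {r : V → V → Prop} {a : V}
    (h : ∀ v, Relation.ReflTransGen r a v) :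
    ∃ d : V → ℕ, d a = 0 ∧ (∀ v, d v < Fintype.card V) ∧
      ∀ v, v ≠ a → ∃ u, r u v ∧ d v = d u + 1 := by
  classical
  -- `R k v`: some walk of length exactly `k` leads from `a` to `v`.
  let R : ℕ → V → Prop :=
    Nat.rec (motive := fun _ => V → Prop) (fun v => v = a) (fun _ P v => ∃ u, P u ∧ r u v)
  have hR : ∀ v, ∃ k, R k v := by
    intro v
    induction h v with
    | refl => exact ⟨0, rfl⟩
    | tail _ huv ih =>
      obtain ⟨k, hk⟩ := ih
      exact ⟨k + 1, _, hk, huv⟩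
  let d : V → ℕ := fun v => Nat.find (hR v)
  have hpred : ∀ v k, d v = k + 1 → ∃ u, r u v ∧ d u = k := by
    intro v k hk
    have hs : R (d v) v := Nat.find_spec (hR v)
    rw [hk] at hs
    obtain ⟨u, hu, huv⟩ := hs
    refine ⟨u, huv, le_antisymm (Nat.find_min' _ hu) ?_⟩
    have hs' : R (d u + 1) v := ⟨u, Nat.find_spec (hR u), huv⟩
    have : d v ≤ d u + 1 := Nat.find_min' _ hs'
    omega
  -- Distances have no gaps: all of `0, …, d v` are attained, so `d v + 1` is at most the number of
  -- vertices.
  have hsub : ∀ k v, d v = k → range (k + 1) ⊆ univ.image d := by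
    intro k
    induction k with
    | zero =>
      intro v hv j hj
      exact mem_image.2 ⟨v, mem_univ v, by rw [mem_range] at hj; omega⟩
    | succ k ih =>
      intro v hv j hj
      obtain ⟨u, -, hu⟩ := hpred v k hv
      rcases Nat.lt_succ_iff_lt_or_eq.1 (mem_range.1 hj) with hj | rfl
      · exact ih u hu (mem_range.2 hj)
      · exact mem_image.2 ⟨v, mem_univ v, hv⟩
  refine ⟨d, Nat.le_zero.1 (Nat.find_min' _ rfl), fun v => ?_, fun v hv => ?_⟩
  · have := (card_le_card (hsub _ v rfl)).trans card_image_le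
    rwa [card_range] at this
  · rcases hd : d v with _ | k
    · have hs : R (d v) v := Nat.find_spec (hR v)
      rw [hd] at hs
      exact absurd hs hv
    · obtain ⟨u, huv, hu⟩ := hpred v k hd
      exact ⟨u, huv, by rw [hu]⟩

/-! ### The test vector for the follower block -/

namespace LeaderFollowerGraph

variable {N : ℕ} (G : LeaderFollowerGraph N)

theorem laplacian_apply_of_ne {i j : Fin (N + 1)} (hij : i ≠ j) :
    G.laplacian i j = -G.weight i j := by
  simp [laplacian, degreeMatrix, Matrix.diagonal_apply_ne _ hij]

theorem laplacian_apply_self (i : Fin (N + 1)) :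
    G.laplacian i i = ∑ j ∈ univ.erase i, G.weight i j := by
  rw [laplacian, degreeMatrix, Matrix.sub_apply, Matrix.diagonal_apply_eq,
    ← add_sum_erase _ _ (mem_univ i), add_sub_cancel_left]

theorem laplacian_mulVec_apply (w : Fin (N + 1) → ℝ) (i : Fin (N + 1)) :
    (G.laplacian *ᵥ w) i = ∑ j ∈ univ.erase i, G.weight i j * (w i - w j) := by
  simp only [Matrix.mulVec, dotProduct]
  rw [← add_sum_erase _ _ (mem_univ i), laplacian_apply_self, sum_mul, ← sum_add_distrib]
  refine sum_congr rfl fun j hj => ?_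
  rw [G.laplacian_apply_of_ne (ne_of_mem_erase hj).symm]
  ring

theorem followerBlock_mulVec_apply (w : Fin (N + 1) → ℝ) (h0 : w 0 = 0) (i : Fin N) :
    (G.followerBlock *ᵥ fun j => w j.succ) i = (G.laplacian *ᵥ w) i.succ := by
  simp [Matrix.mulVec, dotProduct, followerBlock, Fin.sum_univ_succ, h0]

/-- A lower bound for the Laplacian at a vertex `i` that has an in-neighbour `u` with a smaller
value of `w`, in terms of an upper bound `M` of `w`. -/
theorem le_laplacian_mulVec {ε₁ ε₂ M : ℝ} {w : Fin (N + 1) → ℝ} (hM : ∀ j, w j ≤ M)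
    {i u : Fin (N + 1)} (hui : u ≠ i) (hε₁ : ε₁ ≤ G.weight i u) (hε₂ : G.laplacian i i ≤ ε₂) :
    ε₁ * (M - w u) - ε₂ * (M - w i) ≤ (G.laplacian *ᵥ w) i := by
  -- Measuring `w` downwards from `M` makes every summand nonnegative, so all but the one at `u` can
  -- be dropped.
  have h1 : (G.laplacian *ᵥ w) i = ∑ j ∈ univ.erase i, G.weight i j * (M - w j)
      - G.laplacian i i * (M - w i) := by
    rw [laplacian_mulVec_apply, laplacian_apply_self, sum_mul, ← sum_sub_distrib]
    exact sum_congr rfl fun j _ => by ring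
  have h2 : G.weight i u * (M - w u) ≤ ∑ j ∈ univ.erase i, G.weight i j * (M - w j) :=
    single_le_sum (f := fun j => G.weight i j * (M - w j))
      (fun j _ => mul_nonneg (G.weight_nonneg i j) (sub_nonneg.2 (hM j)))
      (mem_erase.2 ⟨hui, mem_univ u⟩)
  have h3 := mul_le_mul_of_nonneg_right hε₁ (sub_nonneg.2 (hM u))
  have h4 := mul_le_mul_of_nonneg_right hε₂ (sub_nonneg.2 (hM i))
  linarith

/-- The eigenvalues of the follower block have real part at least `ε₁ / ∑_{k < N} (ε₂ / ε₁) ^ k`. -/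
theorem div_geom_sum_le_re {ε₁ ε₂ : ℝ} (hε₁ : 0 < ε₁) (hε₂ : 0 < ε₂)
    (hG : G.HasSpanningTreeFromLeader)
    (hL : ∀ i j, G.laplacian i j ≠ 0 → ε₁ ≤ |G.laplacian i j| ∧ |G.laplacian i j| ≤ ε₂)
    {z : ℂ} (hz : z ∈ eigenvalues G.followerBlock) :
    ε₁ / ∑ k ∈ range N, (ε₂ / ε₁) ^ k ≤ z.re := by
  obtain ⟨d, hd0, hdN, hd⟩ := exists_level_of_reflTransGen hG
  simp only [Fintype.card_fin] at hdN
  set r : ℝ := ε₂ / ε₁ with hr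
  have hr0 : 0 < r := div_pos hε₂ hε₁
  set T : ℕ → ℝ := fun n => ∑ k ∈ range n, r ^ k with hT
  have hTgeom : ∀ n, ε₂ * T n = ε₁ * (T (n + 1) - 1) := by
    intro n
    have h := geom_sum_succ (x := r) (n := n)
    have hrε : ε₁ * r = ε₂ := mul_div_cancel₀ _ hε₁.ne'
    simp only [hT, h, ← hrε]
    ring
  have hTmono : StrictMono T := strictMono_nat_of_lt_succ fun n => by
    simp only [hT, sum_range_succ]
    linarith [pow_pos hr0 n]
  have hT0 : ∀ n, 0 ≤ T n := fun n => sum_nonneg fun k _ => (pow_pos hr0 k).le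
  set w : Fin (N + 1) → ℝ := fun v => T N - T (N - d v) with hw
  have hw0 : w 0 = 0 := by simp [hw, hd0]
  have hwM : ∀ v, w v ≤ T N := fun v => sub_le_self _ (hT0 _)
  refine le_re_of_mem_eigenvalues_of_smul_le_mulVec G.followerBlock (w := fun i => w i.succ)
    (fun i j hij => ?_) (fun i => ?_) (fun i => ?_) hz
  · rw [followerBlock, Matrix.submatrix_apply,
      G.laplacian_apply_of_ne fun h => hij (Fin.succ_injective _ h)]
    exact neg_nonpos.2 (G.weight_nonneg _ _)
  · obtain ⟨u, -, hu⟩ := hd i.succ (Fin.succ_ne_zero i)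
    exact sub_pos.2 (hTmono (by have := hdN i.succ; omega))
  · rw [G.followerBlock_mulVec_apply w hw0]
    obtain ⟨u, hui, hu⟩ := hd i.succ (Fin.succ_ne_zero i)
    have hne : u ≠ i.succ := by
      rintro rfl
      omega
    have hweight : 0 < G.weight i.succ u := hui
    have h1 : ε₁ ≤ G.weight i.succ u := by
      have h := G.laplacian_apply_of_ne hne.symm
      have h' := (hL i.succ u (by rw [h]; linarith)).1
      rwa [h, abs_neg, abs_of_pos hweight] at h'
    have h2 : G.laplacian i.succ i.succ ≤ ε₂ := by
      by_cases h : G.laplacian i.succ i.succ = 0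
      · rw [h]; exact hε₂.le
      · exact (le_abs_self _).trans (hL _ _ h).2
    refine le_trans ?_ (G.le_laplacian_mulVec hwM hne h1 h2)
    have hwu : T N - w u = T (N - d i.succ + 1) := by
      have := hdN i.succ
      rw [show N - d i.succ + 1 = N - d u by omega]
      simp [hw]
    have hwi : T N - w i.succ = T (N - d i.succ) := by simp [hw]
    have hTN : 0 < T N := by
      have h := hTmono (i.pos)
      simpa [hT] using h
    -- By the recursion for `T`, the lower bound collapses to exactly `ε₁`.
    rw [hwu, hwi, hTgeom]
    calc ε₁ / T N * w i.succ ≤ ε₁ / T N * T N :=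
          mul_le_mul_of_nonneg_left (hwM _) (div_pos hε₁ hTN).le
      _ = ε₁ * T (N - d i.succ + 1) - ε₁ * (T (N - d i.succ + 1) - 1) := by
          rw [div_mul_cancel₀ _ hTN.ne']
          ring

/-- A follower exists and has an in-edge, so some Laplacian entry is nonzero and lies between the
two bounds. -/
theorem le_of_laplacian_bounds {ε₁ ε₂ : ℝ} (hN : 1 ≤ N) (hG : G.HasSpanningTreeFromLeader)
    (hL : ∀ i j, G.laplacian i j ≠ 0 → ε₁ ≤ |G.laplacian i j| ∧ |G.laplacian i j| ≤ ε₂) :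
    ε₁ ≤ ε₂ := by
  obtain ⟨d, -, -, hd⟩ := exists_level_of_reflTransGen hG
  obtain ⟨u, hu, hdu⟩ := hd (Fin.last N) (by rw [Ne, Fin.last_eq_zero_iff]; omega)
  have hne : Fin.last N ≠ u := by
    intro h
    rw [← h] at hdu
    omega
  have hpos : 0 < G.weight (Fin.last N) u := hu
  have h := hL (Fin.last N) u (by rw [G.laplacian_apply_of_ne hne]; linarith)
  exact h.1.trans h.2

end LeaderFollowerGraph

/-- The ratio is at least `1`, so each term of the geometric sum is at most the last one; the factor
`2 ^ (N - 1)` is simply given away. -/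
theorem pow_div_le_div_geom_sum {ε₁ ε₂ : ℝ} (hε₁ : 0 < ε₁) (h : ε₁ ≤ ε₂) {N : ℕ} (hN : 1 ≤ N) :
    ε₁ ^ N / (N * (2 * ε₂) ^ (N - 1)) ≤ ε₁ / ∑ k ∈ range N, (ε₂ / ε₁) ^ k := by
  obtain ⟨n, rfl⟩ : ∃ n, N = n + 1 := ⟨N - 1, by omega⟩
  have hε₂ : 0 < ε₂ := hε₁.trans_le h
  have hr : 1 ≤ ε₂ / ε₁ := (one_le_div hε₁).2 h
  have hsum : ∑ k ∈ range (n + 1), (ε₂ / ε₁) ^ k ≤ (n + 1 : ℕ) * (ε₂ / ε₁) ^ n := by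
    have h' := sum_le_card_nsmul (range (n + 1)) (fun k => (ε₂ / ε₁) ^ k) ((ε₂ / ε₁) ^ n)
      fun k hk => pow_le_pow_right₀ hr (Nat.lt_succ_iff.1 (mem_range.1 hk))
    rwa [card_range, nsmul_eq_mul] at h'
  have hpos : 0 < ∑ k ∈ range (n + 1), (ε₂ / ε₁) ^ k :=
    sum_pos (fun k _ => pow_pos (div_pos hε₂ hε₁) k) ⟨0, by simp⟩
  calc ε₁ ^ (n + 1) / ((n + 1 : ℕ) * (2 * ε₂) ^ (n + 1 - 1))
      ≤ ε₁ ^ (n + 1) / ((n + 1 : ℕ) * ε₂ ^ n) := by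
        rw [Nat.add_sub_cancel]
        gcongr
        linarith
    _ = ε₁ / ((n + 1 : ℕ) * (ε₂ / ε₁) ^ n) := by
        rw [div_pow, pow_succ']
        field_simp
    _ ≤ ε₁ / ∑ k ∈ range (n + 1), (ε₂ / ε₁) ^ k :=
        div_le_div_of_nonneg_left hε₁.le hpos hsum

end CoopReg

theorem theoremt1 {N q : ℕ} (hN : 1 ≤ N) (hq : 1 ≤ q)
    (S : Matrix (Fin q) (Fin q) ℝ)
    (hS : ∀ z ∈ CoopReg.eigenvalues S, 0 ≤ z.re)
    (ε₁ ε₂ : ℝ) (hε₁ : 0 < ε₁) (hε₂ : 0 < ε₂)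
    (G : CoopReg.LeaderFollowerGraph N)
    (hG : G.HasSpanningTreeFromLeader)
    (hL : ∀ i j, G.laplacian i j ≠ 0 → ε₁ ≤ |G.laplacian i j| ∧ |G.laplacian i j| ≤ ε₂) :
    ε₁ ^ N / (N * (2 * ε₂) ^ (N - 1)) ≤ CoopReg.minRe G.followerBlock ∧
    ∀ μ : ℝ, μ > CoopReg.maxRe S * N * (2 * ε₂) ^ (N - 1) / ε₁ ^ N →
      CoopReg.IsHurwitz
        ((1 : Matrix (Fin N) (Fin N) ℝ) ⊗ₖ S
          - μ • (G.followerBlock ⊗ₖ (1 : Matrix (Fin q) (Fin q) ℝ))) := by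
  have : Nonempty (Fin N) := ⟨⟨0, hN⟩⟩
  have : Nonempty (Fin q) := ⟨⟨0, hq⟩⟩
  have hbound : ∀ z ∈ CoopReg.eigenvalues G.followerBlock,
      ε₁ ^ N / (N * (2 * ε₂) ^ (N - 1)) ≤ z.re := fun z hz =>
    (CoopReg.pow_div_le_div_geom_sum hε₁ (G.le_of_laplacian_bounds hN hG hL) hN).trans
      (G.div_geom_sum_le_re hε₁ hε₂ hG hL hz)
  refine ⟨?_, fun μ hμ z hz => ?_⟩
  · obtain ⟨z, hz, hmin⟩ := (CoopReg.isLeast_minRe G.followerBlock).1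
    rw [← hmin]
    exact hbound z hz
  · obtain ⟨s, hs, h, hh, rfl⟩ :=
      CoopReg.exists_eigenvalues_of_mem_eigenvalues_kronecker _ _ _ hz
    have hsmax : s.re ≤ CoopReg.maxRe S := (CoopReg.isGreatest_maxRe S).2 ⟨s, hs, rfl⟩
    have hmax0 : 0 ≤ CoopReg.maxRe S := (hS s hs).trans hsmax
    have hN0 : (0 : ℝ) < N := Nat.cast_pos.2 hN
    have hden : 0 < N * (2 * ε₂) ^ (N - 1) := by positivity
    -- The assumption on `S` enters here: the threshold is nonnegative, so the bound on `Re h` may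
    -- be multiplied by `μ`.
    have hμ0 : 0 < μ := lt_of_le_of_lt (by positivity) hμ
    have hkey : CoopReg.maxRe S < μ * (ε₁ ^ N / (N * (2 * ε₂) ^ (N - 1))) := by
      rw [gt_iff_lt, div_lt_iff₀ (pow_pos hε₁ N)] at hμ
      rw [← mul_div_assoc, lt_div_iff₀ hden]
      linarith
    have hle := mul_le_mul_of_nonneg_left (hbound h hh) hμ0.le
    have hre : (s - μ * h).re = s.re - μ * h.re := by simp
    rw [hre]
    linarith
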